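/- **Setting.** Let $m\ge 2$ and let $\mathbb{C}_m$ be the complex Clifford algebra with generators $e_1,\dots,e_m$, $e_j^2=-1$, $e_ie_j=-e_je_i$ for $i\ne j$, and basis $e_A=e_{j_1}\cdots e_{j_h}$, $A=\{j_1<\dots<j_h\}\subseteq\{1,\dots,m\}$. Let $\lambda\mapsto\overline{\lambda}$ be the Hermitian conjugation (the conjugate-linear anti-automorphism with $\overline{e_j}=-e_j$), and for $\lambda=\sum_A\lambda_Ae_A$ put $|\lambda|^2=\sum_A|\lambda_A|^2$. Let $\partial_x=\sum_{j=1}^m e_j\partial_{x_j}$ be the Dirac operator on $\mathbb{C}_m$-valued functions on $\mathbb{R}^m$. For $k\ge 0$ let $M_l^+(k)$ be the set of $\mathbb{C}_m$-valued homogeneous polynomials $Y$ of degree $k$ on $\mathbb{R}^m$ with $\partial_xY=0$. For $\alpha>-1$, $n\ge0$ and $Y\in M_l^+(k)$, the Clifford–Gegenbauer polynomial is, for $x$ in the open unit ball $B(1)$, $$C_{n,m}^{\alpha}(Y)(x)=(1-|x|^2)^{-\alpha}\,\partial_x^{\,n}\big((1-|x|^2)^{\alpha+n}\,Y(x)\big),$$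 and the norm of $L^2_\alpha(B(1),\mathbb{C}_m)$ is $$\|f\|_\alpha=\Big(\int_{B(1)}|f(x)|^2(1-|x|^2)^\alpha\,dx\Big)^{1/2}.$$ **Theorem.** Let $m\ge2$, $\alpha>-1$, and let $k,N\ge0$ be integers. Let $(Y_k^j)_j$ be an orthonormal family in $M_l^+(k)$ (for example an orthonormal basis), that is, $$\int_{S^{m-1}}\overline{Y_k^{i}(\omega)}\,Y_k^{j}(\omega)\,d\omega=\delta_{ij},$$ where $d\omega$ is the (unnormalized) surface measure. Then for every $j$ the functions $C_{2N,m}^\alpha(Y_k^j)$ and $C_{2N+1,m}^\alpha(Y_k^j)$ belong to $L^2_\alpha(B(1),\mathbb{C}_m)$, and $$\|C_{2N,m}^{\alpha}(Y_k^j)\|_\alpha^2=\frac{2^{4N}\,\Gamma(\alpha+2N+1)^2\,\Gamma(k+\frac m2+N)\,N!}{2\,\Gamma(\alpha+N+1)\,\Gamma(\alpha+k+\frac m2+N)\,(\alpha+k+\frac m2+2N)},$$ $$\|C_{2N+1,m}^{\alpha}(Y_k^j)\|_\alpha^2=\frac{2^{4N+2}\,\Gamma(\alpha+2N+2)^2\,\Gamma(k+\frac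 m2+N+1)\,N!}{2\,\Gamma(\alpha+N+1)\,\Gamma(\alpha+k+\frac m2+N+1)\,(\alpha+k+\frac m2+2N+1)}.$$ -/

import Mathlib

namespace CliffordGegenbauer

noncomputable section

open MeasureTheory

/-- Euclidean space `ℝ^m`. -/
abbrev E (m : ℕ) : Type := EuclideanSpace ℝ (Fin m)

/-- The underlying space of the complex Clifford algebra `ℂ_m`: an element `∑_A λ_A e_A`, with `A`
running over the subsets of `{1, …, m}`, is given by its coefficients `λ_A`.  The norm of this
Euclidean space is `|λ|² = ∑_A |λ_A|²`. -/
abbrev Cl (m : ℕ) : Type := EuclideanSpace ℂ (Finset (Fin m))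

namespace Cl

variable {m : ℕ}

/-- The basis element `e_A = e_{j₁} ⋯ e_{j_h}` for `A = {j₁ < ⋯ < j_h}`. -/
def blade (A : Finset (Fin m)) : Cl m := EuclideanSpace.single A 1

/-- The sign in `e_A e_B = ± e_{A ∆ B}`: one factor `-1` for every transposition of distinct
generators needed to sort the word (pairs `i ∈ A`, `j ∈ B` with `j < i`), and one for every
cancellation `e_j² = -1` (pairs with `j = i`). -/
def sign (A B : Finset (Fin m)) : ℂ := (-1) ^ ((A ×ˢ B).filter fun p => p.2 ≤ p.1).card

/-- The Clifford product: the bilinear product with `e_A e_B = sign A B • e_{A ∆ B}`, which is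
the associative product with `e_j² = -1` and `e_i e_j = - e_j e_i` for `i ≠ j`. -/
def mul (a b : Cl m) : Cl m :=
  ∑ A, ∑ B, (sign A B * a A * b B) • blade (symmDiff A B)

/-- The identity element `e_∅`. -/
def one : Cl m := blade ∅

/-- The generator `e_j`. -/
def gen (j : Fin m) : Cl m := blade {j}

/-- Hermitian conjugation: conjugate-linear, with `conj e_A = (-1)^{h(h+1)/2} e_A` for `|A| = h`;
it is the anti-automorphism with `conj e_j = - e_j`. -/
def conj (a : Cl m) : Cl m :=
  ∑ A, ((-1 : ℂ) ^ (A.card * (A.card + 1) / 2) * starRingEnd ℂ (a A)) • blade A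

/-- The scalar part `[λ]_0`. -/
def scalarPart (a : Cl m) : ℂ := a ∅

theorem sign_eq_prod (A B : Finset (Fin m)) :
    sign A B = ∏ i ∈ A, ∏ j ∈ B, (if j ≤ i then (-1 : ℂ) else 1) := by
  rw [← Finset.prod_product', sign, Finset.prod_ite]
  simp

theorem prod_symmDiff (f : Fin m → ℂ) (hf : ∀ i, f i * f i = 1) (A B : Finset (Fin m)) :
    ∏ i ∈ symmDiff A B, f i = (∏ i ∈ A, f i) * ∏ i ∈ B, f i := by
  have h1 : ∀ S : Finset (Fin m), ∏ i ∈ S, f i = ∏ i, if i ∈ S then f i else 1 := by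
    intro S; simp
  rw [h1, h1 A, h1 B, ← Finset.prod_mul_distrib]
  refine Finset.prod_congr rfl fun i _ => ?_
  by_cases hA : i ∈ A <;> by_cases hB : i ∈ B <;> simp [Finset.mem_symmDiff, hA, hB, hf]

theorem sign_sq (A B : Finset (Fin m)) : sign A B ^ 2 = 1 := by
  rw [sign, ← pow_mul, mul_comm, pow_mul]
  simp

theorem sign_symmDiff_left (A B C : Finset (Fin m)) :
    sign (symmDiff A B) C = sign A C * sign B C := by
  simp only [sign_eq_prod]
  refine prod_symmDiff _ (fun i => ?_) A B
  rw [← Finset.prod_mul_distrib]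
  exact Finset.prod_eq_one fun j _ => by split_ifs <;> norm_num

theorem sign_symmDiff_right (A B C : Finset (Fin m)) :
    sign A (symmDiff B C) = sign A B * sign A C := by
  simp only [sign_eq_prod]
  rw [← Finset.prod_mul_distrib]
  refine Finset.prod_congr rfl fun i _ => ?_
  exact prod_symmDiff _ (fun j => by split_ifs <;> norm_num) B C

theorem sign_self (A : Finset (Fin m)) :
    sign A A = (-1) ^ (A.card * (A.card + 1) / 2) := by
  unfold sign
  congr 1
  induction A using Finset.induction_on_max with
  | empty => simp
  | insert a s hs ih =>
    have ha : a ∉ s := fun h => lt_irrefl _ (hs a h)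
    have h1 : ((insert a s ×ˢ insert a s).filter fun p : Fin m × Fin m => p.2 ≤ p.1)
        = ((s ×ˢ s).filter fun p => p.2 ≤ p.1) ∪ ({a} ×ˢ insert a s) := by
      ext ⟨i, j⟩
      simp only [Finset.mem_filter, Finset.mem_product, Finset.mem_insert, Finset.mem_union,
        Finset.mem_singleton]
      constructor
      · rintro ⟨⟨rfl | hi, rfl | hj⟩, h⟩
        · simp
        · simp [hj]
        · exact absurd (hs i hi) (not_lt.2 h)
        · simp [hi, hj, h]
      · rintro (⟨⟨hi, hj⟩, h⟩ | ⟨rfl, rfl | hj⟩)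
        · simp [hi, hj, h]
        · simp
        · simp [hj, (hs j hj).le]
    rw [h1, Finset.card_union_of_disjoint, ih, Finset.card_product, Finset.card_singleton,
      Finset.card_insert_of_notMem ha]
    · have : (s.card + 1) * (s.card + 1 + 1) = s.card * (s.card + 1) + 2 * (s.card + 1) := by ring
      rw [this]
      omega
    · rw [Finset.disjoint_left]
      rintro ⟨i, j⟩ h h'
      simp only [Finset.mem_filter, Finset.mem_product, Finset.mem_singleton] at h h'
      exact ha (h'.1 ▸ h.1.1)

theorem mul_apply (a b : Cl m) (C : Finset (Fin m)) :
    mul a b C = ∑ A, sign A (symmDiff A C) * a A * b (symmDiff A C) := by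
  simp only [mul, blade, PiLp.smul_apply, WithLp.ofLp_sum, Finset.sum_apply,
    PiLp.single_apply, smul_eq_mul, mul_ite, mul_one, mul_zero]
  refine Finset.sum_congr rfl fun A _ => ?_
  rw [Finset.sum_eq_single (symmDiff A C)]
  · simp
  · intro B _ hB
    rw [if_neg]
    rintro rfl
    simp at hB
  · simp

theorem mul_assoc (a b c : Cl m) : mul (mul a b) c = mul a (mul b c) := by
  ext D
  simp only [mul_apply, Finset.mul_sum, Finset.sum_mul]
  rw [Finset.sum_comm]
  refine Finset.sum_congr rfl fun A _ => ?_
  rw [← Equiv.sum_comp (symmDiff_right_involutive A).toPerm]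
  refine Finset.sum_congr rfl fun B _ => ?_
  simp only [Function.Involutive.coe_toPerm, symmDiff_symmDiff_cancel_left, symmDiff_assoc,
    sign_symmDiff_left, sign_symmDiff_right]
  rw [symmDiff_left_comm A B D]
  linear_combination (sign A A * sign B A * sign B B * sign A D * sign B D * a A * b B *
    c (symmDiff B (symmDiff A D))) * sign_sq A B

theorem blade_mul_blade (A B : Finset (Fin m)) :
    mul (blade A) (blade B) = sign A B • blade (symmDiff A B) := by
  rw [mul, Finset.sum_eq_single A, Finset.sum_eq_single B]
  · simp [blade]
  · intro C _ hC
    simp [blade, hC]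
  · simp
  · intro C _ hC
    simp [blade, hC]
  · simp

theorem one_mul (a : Cl m) : mul one a = a := by
  ext C
  rw [mul_apply, Finset.sum_eq_single ∅]
  · have h : symmDiff ∅ C = C := bot_symmDiff C
    simp [one, blade, sign, h]
  · intro A _ hA
    simp [one, blade, hA]
  · simp

theorem mul_one (a : Cl m) : mul a one = a := by
  ext C
  rw [mul_apply, Finset.sum_eq_single C]
  · simp [one, blade, sign]
  · intro A _ hA
    have : symmDiff A C ≠ ∅ := by
      rw [← Finset.bot_eq_empty, Ne, symmDiff_eq_bot]
      exact hA
    simp [one, blade, this]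
  · simp

theorem gen_mul_self (j : Fin m) : mul (gen j) (gen j) = -one := by
  have h : sign {j} {j} = -1 := by simp [sign_eq_prod]
  simp [gen, blade_mul_blade, h, one]

theorem gen_anticomm {i j : Fin m} (h : i ≠ j) :
    mul (gen i) (gen j) = -mul (gen j) (gen i) := by
  have h' : sign {i} {j} = -sign {j} {i} := by
    rcases lt_or_gt_of_ne h with h | h <;> simp [sign_eq_prod, h.le, not_le.2 h]
  rw [gen, gen, blade_mul_blade, blade_mul_blade, h', symmDiff_comm, neg_smul]

theorem conj_apply (a : Cl m) (A : Finset (Fin m)) :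
    conj a A = sign A A * starRingEnd ℂ (a A) := by
  simp only [conj, blade, PiLp.smul_apply, WithLp.ofLp_sum, Finset.sum_apply,
    PiLp.single_apply, smul_eq_mul, mul_ite, _root_.mul_one, mul_zero]
  simp [sign_self]

theorem conj_sign (A B : Finset (Fin m)) : starRingEnd ℂ (sign A B) = sign A B := by
  simp [sign]

theorem conj_gen (j : Fin m) : conj (gen j) = -gen j := by
  ext A
  by_cases h : A = {j}
  · subst h
    simp [conj_apply, gen, blade, sign_eq_prod]
  · simp [conj_apply, gen, blade, h]

theorem conj_mul (a b : Cl m) : conj (mul a b) = mul (conj b) (conj a) := by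
  ext C
  simp only [mul_apply, conj_apply, map_sum, map_mul, Finset.mul_sum, conj_sign]
  rw [← Equiv.sum_comp (symmDiff_left_involutive C).toPerm]
  refine Finset.sum_congr rfl fun A _ => ?_
  simp only [Function.Involutive.coe_toPerm, symmDiff_symmDiff_cancel_right,
    sign_symmDiff_left, sign_symmDiff_right]
  linear_combination (-(sign C C * sign A A * sign C A * starRingEnd ℂ (a (symmDiff A C)) *
    starRingEnd ℂ (b A))) * (sign A C ^ 2 * sign_sq A A + sign_sq A C)

theorem scalarPart_conj_mul_self (a : Cl m) :
    scalarPart (mul (conj a) a) = ((‖a‖ ^ 2 : ℝ) : ℂ) := by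
  rw [scalarPart, mul_apply, EuclideanSpace.norm_sq_eq, Complex.ofReal_sum]
  refine Finset.sum_congr rfl fun A _ => ?_
  rw [← Finset.bot_eq_empty, symmDiff_bot, conj_apply, Complex.ofReal_pow,
    ← Complex.conj_mul']
  linear_combination (starRingEnd ℂ (a A) * a A) * sign_sq A A

end Cl

/-- The Dirac operator `∂_x f = ∑_j e_j ∂f/∂x_j`. -/
def dirac {m : ℕ} (f : E m → Cl m) : E m → Cl m := fun x =>
  ∑ j : Fin m, Cl.mul (Cl.gen j) (fderiv ℝ f x (EuclideanSpace.single j 1))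

/-- A function on `ℝ^m` is left monogenic if it is `C^1` and `∂_x f = 0`. -/
def IsLeftMonogenic {m : ℕ} (f : E m → Cl m) : Prop :=
  ContDiff ℝ 1 f ∧ ∀ x, dirac f x = 0

/-- Homogeneous polynomials of degree `k` on `ℝ^m` with coefficients in the Clifford algebra. -/
def IsHomogeneousPolynomial {m : ℕ} (k : ℕ) (f : E m → Cl m) : Prop :=
  ∃ P : Finset (Fin m) → MvPolynomial (Fin m) ℂ, (∀ A, (P A).IsHomogeneous k) ∧
    ∀ x A, f x A = MvPolynomial.eval (fun i => (x i : ℂ)) (P A)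

/-- The space `M_l^+(k)` of left solid inner spherical monogenics of order `k`. -/
def sphericalMonogenics (m k : ℕ) : Set (E m → Cl m) :=
  {f | IsHomogeneousPolynomial k f ∧ IsLeftMonogenic f}

/-- The Clifford-valued inner product `∫_{S^{m-1}} conj(f(ω)) g(ω) dω`, with the (unnormalized)
surface measure on the unit sphere. -/
def sphereInner {m : ℕ} (f g : E m → Cl m) : Cl m :=
  ∫ ω : Metric.sphere (0 : E m) 1, Cl.mul (Cl.conj (f ω)) (g ω)
    ∂((volume : Measure (E m)).toSphere)

/-- The Clifford-Gegenbauer polynomial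
`C_{n,m}^α(Y)(x) = (1-|x|²)^{-α} ∂_x^n ((1-|x|²)^{α+n} Y(x))`. Only its values on the open unit
ball matter. -/
def cgp {m : ℕ} (α : ℝ) (n : ℕ) (Y : E m → Cl m) : E m → Cl m := fun x =>
  ((1 - ‖x‖ ^ 2) ^ (-α) : ℝ) •
    (dirac^[n] fun y => ((1 - ‖y‖ ^ 2) ^ (α + n) : ℝ) • Y y) x

/-- Membership in `L²_α(B(1), ℂ_m)`. -/
def MemL2 {m : ℕ} (α : ℝ) (f : E m → Cl m) : Prop :=
  AEStronglyMeasurable f (volume.restrict (Metric.ball (0 : E m) 1)) ∧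
    IntegrableOn (fun x => ‖f x‖ ^ 2 * (1 - ‖x‖ ^ 2) ^ α) (Metric.ball (0 : E m) 1)

/-- The norm `‖f‖_α = (∫_{B(1)} |f(x)|² (1-|x|²)^α dx)^{1/2}`. -/
def weightedNorm {m : ℕ} (α : ℝ) (f : E m → Cl m) : ℝ :=
  Real.sqrt (∫ x in Metric.ball (0 : E m) 1, ‖f x‖ ^ 2 * (1 - ‖x‖ ^ 2) ^ α)

end

end CliffordGegenbauer

/-! Put s = |x|² and b = k + m/2. For a spherical monogenic Y of degree k, ∂(φ(s)Y) = 2φ'(s) xY, and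
since x² = -|x|² and Y is an Euler eigenvector, ∂(ψ(s)xY) = -2(bψ + sψ')Y. Hence on the ball the
Clifford–Gegenbauer function is P_n(s)Y or P_n(s)xY, with P_n a real polynomial (`iterate_dirac`,
`cgp_eq_radialFun`). In polar coordinates the sphere contributes the scalar part of the inner
product of Y with itself, which is 1. The substitution s = r² turns the radial part into half the
integral of P_n², or of s P_n², against s^(b-1) (1-s)^α (`memL2_cgp_and_weightedNorm_sq`). This is
evaluated as for Rodrigues formulas: one factor P_n is unrolled and integrated by parts. Two steps
of the recursion are adjoint, up to the factor -4, to Lq = bq' + sq'' (`betaMoment_mul_radialPoly`).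
As L lowers the degree by one, N double steps reduce a polynomial of degree at most N to a constant
seen only by its coefficient of s^N (`iterate_besselOp`, `coeff_radialPoly`), and an Euler beta
integral remains. The assumption m ≥ 2 gives b ≥ 1, so α + b > 0 and the Gamma arguments that occur
are positive. -/

namespace CliffordGegenbauer

noncomputable section

open MeasureTheory

/-! ### Beta integrals and the radial polynomials -/

section BetaMoment

open Polynomial Set

/-- The integral of a polynomial against the beta weight `s ^ (b - 1) * (1 - s) ^ (d - 1)`. -/
def betaMoment (b d : ℝ) (P : ℝ[X]) : ℝ :=
  ∫ s in Ioo (0 : ℝ) 1, P.eval s * (s ^ (b - 1) * (1 - s) ^ (d - 1))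

theorem ofReal_rpow_mul_one_sub_rpow (b d : ℝ) {s : ℝ} (hs : s ∈ Icc (0 : ℝ) 1) :
    ((s : ℂ) ^ ((b : ℂ) - 1) * (1 - (s : ℂ)) ^ ((d : ℂ) - 1)) =
      ((s ^ (b - 1) * (1 - s) ^ (d - 1) : ℝ) : ℂ) := by
  rw [Complex.ofReal_mul, Complex.ofReal_cpow hs.1, Complex.ofReal_cpow (sub_nonneg.2 hs.2)]
  push_cast
  rfl

theorem integrableOn_betaWeight {b d : ℝ} (hb : 0 < b) (hd : 0 < d) :
    IntegrableOn (fun s : ℝ => s ^ (b - 1) * (1 - s) ^ (d - 1)) (Icc 0 1) := by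
  have h := Complex.betaIntegral_convergent (u := b) (v := d) (by simpa) (by simpa)
  rw [intervalIntegrable_iff_integrableOn_Icc_of_le zero_le_one] at h
  have h2 : IntegrableOn (fun s : ℝ => ((s ^ (b - 1) * (1 - s) ^ (d - 1) : ℝ) : ℂ)) (Icc 0 1) :=
    h.congr_fun (fun s hs => ofReal_rpow_mul_one_sub_rpow b d hs) measurableSet_Icc
  exact h2.re

theorem integrableOn_eval_mul_betaWeight {b d : ℝ} (hb : 0 < b) (hd : 0 < d) (P : ℝ[X]) :
    IntegrableOn (fun s : ℝ => P.eval s * (s ^ (b - 1) * (1 - s) ^ (d - 1))) (Ioo 0 1) :=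
  ((integrableOn_betaWeight hb hd).continuousOn_mul P.continuous.continuousOn isCompact_Icc).mono_set
    Ioo_subset_Icc_self

theorem betaMoment_one {b d : ℝ} (hb : 0 < b) (hd : 0 < d) :
    betaMoment b d 1 = Real.Gamma b * Real.Gamma d / Real.Gamma (b + d) := by
  have h := ProbabilityTheory.beta_eq_betaIntegralReal b d hb hd
  rw [ProbabilityTheory.beta] at h
  rw [h, Complex.betaIntegral, intervalIntegral.integral_of_le zero_le_one,
    integral_Ioc_eq_integral_Ioo, betaMoment,
    setIntegral_congr_fun measurableSet_Ioo
      (fun s hs => ofReal_rpow_mul_one_sub_rpow b d (Ioo_subset_Icc_self hs)), integral_complex_ofReal]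
  simp

theorem betaMoment_C {b d : ℝ} (hb : 0 < b) (hd : 0 < d) (c : ℝ) :
    betaMoment b d (C c) = c * (Real.Gamma b * Real.Gamma d / Real.Gamma (b + d)) := by
  rw [← betaMoment_one hb hd, betaMoment, betaMoment, ← integral_const_mul]
  simp

theorem betaMoment_C_mul (b d c : ℝ) (P : ℝ[X]) :
    betaMoment b d (C c * P) = c * betaMoment b d P := by
  rw [betaMoment, betaMoment, ← integral_const_mul]
  simp [mul_assoc]

theorem betaMoment_add {b d : ℝ} (hb : 0 < b) (hd : 0 < d) (P Q : ℝ[X]) :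
    betaMoment b d (P + Q) = betaMoment b d P + betaMoment b d Q := by
  rw [betaMoment, betaMoment, betaMoment, ← integral_add (integrableOn_eval_mul_betaWeight hb hd P)
    (integrableOn_eval_mul_betaWeight hb hd Q)]
  simp [add_mul]

theorem betaMoment_left_succ (b d : ℝ) (P : ℝ[X]) :
    betaMoment (b + 1) d P = betaMoment b d (X * P) := by
  refine setIntegral_congr_fun measurableSet_Ioo fun s hs => ?_
  have : s ^ (b + 1 - 1) = s ^ (b - 1) * s := by
    rw [← Real.rpow_add_one hs.1.ne']; ring_nf
  simp only [this, eval_mul, eval_X]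
  ring

theorem betaMoment_right_succ (b d : ℝ) (P : ℝ[X]) :
    betaMoment b (d + 1) P = betaMoment b d ((1 - X) * P) := by
  refine setIntegral_congr_fun measurableSet_Ioo fun s hs => ?_
  have : (1 - s) ^ (d + 1 - 1) = (1 - s) ^ (d - 1) * (1 - s) := by
    rw [← Real.rpow_add_one (sub_pos.2 hs.2).ne']; ring_nf
  simp only [this, eval_mul, eval_X, eval_sub, eval_one]
  ring

/-- `(1 - s) ^ (d - 1) * evenStep d P` is the derivative of `(1 - s) ^ d * P`. -/
def evenStep (d : ℝ) (P : ℝ[X]) : ℝ[X] := (1 - X) * derivative P - C d * P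

/-- `s ^ (b - 1) * (1 - s) ^ (d - 1) * oddStep b d P` is the derivative of
`s ^ b * (1 - s) ^ d * P`. -/
def oddStep (b d : ℝ) (P : ℝ[X]) : ℝ[X] :=
  C b * (1 - X) * P - C d * X * P + X * (1 - X) * derivative P

/-- The integrand is the derivative of `s ^ b * (1 - s) ^ d * P`, which vanishes at both endpoints
because b and d are positive. -/
theorem betaMoment_oddStep {b d : ℝ} (hb : 0 < b) (hd : 0 < d) (P : ℝ[X]) :
    betaMoment b d (oddStep b d P) = 0 := by
  have hint := integrableOn_eval_mul_betaWeight hb hd (oddStep b d P)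
  rw [betaMoment, ← integral_Ioc_eq_integral_Ioo, ← intervalIntegral.integral_of_le zero_le_one]
  rw [intervalIntegral.integral_eq_sub_of_hasDerivAt_of_le
    (f := fun s : ℝ => s ^ b * (1 - s) ^ d * P.eval s) zero_le_one]
  · simp [Real.zero_rpow hb.ne', Real.zero_rpow hd.ne']
  · refine Continuous.continuousOn ?_
    have h1 := Real.continuous_rpow_const hb.le
    have h2 := (Real.continuous_rpow_const hd.le).comp
      ((continuous_const (y := (1 : ℝ))).sub continuous_id)
    exact (h1.mul h2).mul P.continuous
  · intro s hs
    have hs1 : 0 < 1 - s := sub_pos.2 hs.2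
    have h1 := Real.hasDerivAt_rpow_const (x := s) (p := b) (Or.inl hs.1.ne')
    have h2 := ((hasDerivAt_id s).const_sub 1).rpow_const (p := d) (Or.inl hs1.ne')
    have h := (h1.mul h2).mul (P.hasDerivAt s)
    refine h.congr_deriv ?_
    have e1 : s ^ b = s ^ (b - 1) * s := by rw [← Real.rpow_add_one hs.1.ne']; ring_nf
    have e2 : (1 - s) ^ d = (1 - s) ^ (d - 1) * (1 - s) := by
      rw [← Real.rpow_add_one hs1.ne']; ring_nf
    simp only [oddStep, eval_add, eval_sub, eval_mul, eval_C, eval_X, eval_one, id, e1, e2, Pi.mul_apply]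
    ring
  · rwa [intervalIntegrable_iff_integrableOn_Ioo_of_le zero_le_one]

/-- Integration by parts: `oddStep b d (q * P)` has moment zero and differs from `q * oddStep b d P`
by X(1 - X)q'P; the factors X and 1 - X shift the two parameters. -/
theorem betaMoment_mul_oddStep {b d : ℝ} (hb : 0 < b) (hd : 0 < d) (q P : ℝ[X]) :
    betaMoment b d (q * oddStep b d P) = -betaMoment (b + 1) (d + 1) (derivative q * P) := by
  rw [betaMoment_right_succ, betaMoment_left_succ, eq_neg_iff_add_eq_zero,
    ← betaMoment_add hb hd, ← betaMoment_oddStep hb hd (q * P)]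
  congr 1
  simp only [oddStep, derivative_mul]
  ring

/-- The same exact derivative, grouped differently: `oddStep b d (q * P)` is X q times `evenStep d
P` plus (1 - X)(bq + Xq')P. -/
theorem betaMoment_mul_evenStep {b d : ℝ} (hb : 0 < b) (hd : 0 < d) (q P : ℝ[X]) :
    betaMoment (b + 1) d (q * evenStep d P) =
      -betaMoment b (d + 1) ((C b * q + X * derivative q) * P) := by
  rw [betaMoment_right_succ, betaMoment_left_succ, eq_neg_iff_add_eq_zero,
    ← betaMoment_add hb hd, ← betaMoment_oddStep hb hd (q * P)]
  congr 1
  simp only [oddStep, evenStep, derivative_mul]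
  ring

/-- The polynomials `P` with `∂_x^n ((1 - |x|²) ^ g Y) = (1 - |x|²) ^ (g - n) P(|x|²) x^ε Y`
(`ε = n mod 2`) for a spherical monogenic `Y` of order `k`, where `b = k + m / 2`. -/
def radialPoly (b g : ℝ) : ℕ → ℝ[X]
  | 0 => 1
  | n + 1 => if Even n then C 2 * evenStep (g - n) (radialPoly b g n)
      else C (-2) * oddStep b (g - n) (radialPoly b g n)

theorem radialPoly_two_mul_succ (b g : ℝ) (M : ℕ) :
    radialPoly b g (2 * M + 1) = C 2 * evenStep (g - 2 * M) (radialPoly b g (2 * M)) := by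
  simp [radialPoly]

theorem radialPoly_two_mul_add_two (b g : ℝ) (M : ℕ) :
    radialPoly b g (2 * (M + 1)) =
      C (-4) * oddStep b (g - 2 * M - 1) (evenStep (g - 2 * M) (radialPoly b g (2 * M))) := by
  have h : ¬ Even (2 * M + 1) := by simp
  rw [show 2 * (M + 1) = 2 * M + 1 + 1 by ring, radialPoly, if_neg h, radialPoly_two_mul_succ]
  simp only [oddStep, derivative_mul, derivative_C, zero_mul, zero_add]
  have e : (C (-4) : ℝ[X]) = C (-2) * C 2 := by rw [← C_mul]; norm_num
  rw [e]
  push_cast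
  rw [show g - (2 * (M : ℝ) + 1) = g - 2 * M - 1 by ring]
  ring

/-- The Bessel type operator adjoint to two steps of `radialPoly`. -/
def besselOp (b : ℝ) (q : ℝ[X]) : ℝ[X] := C b * derivative q + X * derivative (derivative q)

/-- Each double step is moved onto q by two integrations by parts, their signs cancelling, and
raises the second parameter by 2. The bound on g keeps every second parameter positive. -/
theorem betaMoment_mul_radialPoly {b g : ℝ} (hb : 0 < b) (M : ℕ) (hg : -1 < g - 2 * M) (q : ℝ[X]) :
    betaMoment b (g - 2 * M + 1) (q * radialPoly b g (2 * M)) =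
      (-4) ^ M * betaMoment b (g + 1) ((besselOp b)^[M] q) := by
  induction M generalizing q with
  | zero => simp [radialPoly]
  | succ M ih =>
    push_cast at hg
    have e : q * radialPoly b g (2 * (M + 1)) = C (-4) * (q * oddStep b (g - 2 * M - 1)
        (evenStep (g - 2 * M) (radialPoly b g (2 * M)))) := by
      rw [radialPoly_two_mul_add_two]; ring
    push_cast
    rw [e, betaMoment_C_mul, show g - 2 * ((M : ℝ) + 1) + 1 = g - 2 * M - 1 by ring,
      betaMoment_mul_oddStep hb (by linarith), sub_add_cancel,
      betaMoment_mul_evenStep hb (by linarith), Function.iterate_succ_apply, pow_succ,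
      mul_assoc, mul_left_comm, ← besselOp, ih (by linarith)]
    ring

/-! ### Degrees and top coefficients -/

theorem coeff_evenStep (d : ℝ) (P : ℝ[X]) (n : ℕ) :
    (evenStep d P).coeff n = (n + 1) * P.coeff (n + 1) - (n + d) * P.coeff n := by
  cases n with
  | zero => simp [evenStep, sub_mul, coeff_derivative]
  | succ n =>
    simp [evenStep, sub_mul, coeff_derivative]
    ring

theorem coeff_succ_oddStep (b d : ℝ) (P : ℝ[X]) (n : ℕ) :
    (oddStep b d P).coeff (n + 1) =
      (b + n + 1) * P.coeff (n + 1) - (b + d + n) * P.coeff n := by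
  have e : oddStep b d P = C b * P - X * (C b * P) - X * (C d * P) + X * derivative P
      - X * (X * derivative P) := by
    rw [oddStep]; ring
  rw [e]
  cases n with
  | zero =>
    simp [coeff_derivative]
    ring
  | succ n =>
    simp [coeff_derivative]
    ring

theorem coeff_besselOp (b : ℝ) (q : ℝ[X]) (n : ℕ) :
    (besselOp b q).coeff n = (b + n) * (n + 1) * q.coeff (n + 1) := by
  cases n with
  | zero => simp [besselOp, coeff_derivative]
  | succ n =>
    simp [besselOp, coeff_derivative]
    ring

/-- The operator lowers degrees by one, so only the coefficient of index M survives; the factors (b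
+ n)(n + 1), n < M, multiply to Γ(b + M)/Γ(b) and M!. -/
theorem iterate_besselOp {b : ℝ} (hb : 0 < b) (M : ℕ) (q : ℝ[X]) (hq : ∀ n, M < n → q.coeff n = 0) :
    (besselOp b)^[M] q = C (q.coeff M * M.factorial * Real.Gamma (b + M) / Real.Gamma b) := by
  induction M generalizing q with
  | zero =>
    ext n
    cases n with
    | zero => simp [(Real.Gamma_pos_of_pos hb).ne']
    | succ n => simp [hq (n + 1) (by omega)]
  | succ M ih =>
    rw [Function.iterate_succ_apply, ih, coeff_besselOp, Nat.factorial_succ]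
    · have h := Real.Gamma_add_one (s := b + M) (by positivity)
      push_cast
      rw [← add_assoc b, h]
      congr 1
      ring
    · intro n hn
      rw [coeff_besselOp, hq _ (by omega), mul_zero]

theorem coeff_radialPoly_eq_zero (b g : ℝ) (M n : ℕ) (hn : M < n) :
    (radialPoly b g (2 * M)).coeff n = 0 := by
  induction M generalizing n with
  | zero => simp [radialPoly, coeff_one]; omega
  | succ M ih =>
    obtain ⟨n, rfl⟩ : ∃ n', n = n' + 1 := ⟨n - 1, by omega⟩
    rw [radialPoly_two_mul_add_two, coeff_C_mul, coeff_succ_oddStep, coeff_evenStep,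
      coeff_evenStep, ih n (by omega), ih _ (by omega), ih _ (by omega)]
    simp

/-- Passing from M to M + 1 multiplies the top coefficient by -4(g - M)(b + g - M - 1), and these
products telescope into Gamma quotients. -/
theorem coeff_radialPoly {b g : ℝ} (hb : 1 ≤ b) (M : ℕ) (hg : -1 < g - 2 * M) :
    (radialPoly b g (2 * M)).coeff M = (-4) ^ M * Real.Gamma (g + 1) * Real.Gamma (b + g) /
      (Real.Gamma (g - M + 1) * Real.Gamma (b + g - M)) := by
  induction M with
  | zero =>
    have h1 : Real.Gamma (g + 1) ≠ 0 := (Real.Gamma_pos_of_pos (by simp at hg; linarith)).ne'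
    have h2 : Real.Gamma (b + g) ≠ 0 := (Real.Gamma_pos_of_pos (by simp at hg; linarith)).ne'
    simp [radialPoly, h1, h2]
  | succ M ih =>
    push_cast at hg ⊢
    have hM : (0 : ℝ) ≤ M := M.cast_nonneg
    rw [radialPoly_two_mul_add_two, coeff_C_mul, coeff_succ_oddStep, coeff_evenStep,
      coeff_evenStep, coeff_radialPoly_eq_zero _ _ M (M + 1) (by omega),
      coeff_radialPoly_eq_zero _ _ M (M + 1 + 1) (by omega), ih (by linarith)]
    have h1 := Real.Gamma_add_one (s := g - M) (by linarith)
    have h2 := Real.Gamma_add_one (s := b + g - (M + 1)) (by linarith)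
    rw [show b + g - ((M : ℝ) + 1) + 1 = b + g - M by ring] at h2
    rw [show g - ((M : ℝ) + 1) + 1 = g - M by ring, h1, h2]
    have h3 : Real.Gamma (g - M) ≠ 0 := (Real.Gamma_pos_of_pos (by linarith)).ne'
    have h4 : Real.Gamma (b + g - (M + 1)) ≠ 0 := (Real.Gamma_pos_of_pos (by linarith)).ne'
    have h5 : g - M ≠ 0 := by linarith
    have h6 : b + g - (M + 1) ≠ 0 := by linarith
    field_simp
    ring

/-! ### The two beta integrals in closed form -/

theorem betaMoment_radialPoly_even {b α : ℝ} (hb : 1 ≤ b) (hα : -1 < α) (N : ℕ) :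
    betaMoment b (α + 1) (radialPoly b (α + 2 * N) (2 * N) ^ 2) =
      2 ^ (4 * N) * Real.Gamma (α + 2 * N + 1) ^ 2 * Real.Gamma (b + N) * N.factorial /
        (Real.Gamma (α + N + 1) * Real.Gamma (α + b + N) * (α + b + 2 * N)) := by
  have hN : (0 : ℝ) ≤ N := N.cast_nonneg
  have hb0 : 0 < b := by linarith
  have hg : -1 < α + 2 * N - 2 * N := by linarith
  -- The polynomial, of degree at most N, is its own test function.
  have h := betaMoment_mul_radialPoly hb0 N hg (radialPoly b (α + 2 * N) (2 * N))
  rw [iterate_besselOp hb0 N _ (coeff_radialPoly_eq_zero b _ N), coeff_radialPoly hb N hg,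
    betaMoment_C hb0 (by linarith)] at h
  rw [sq, show α + 1 = α + 2 * N - 2 * N + 1 by ring, h,
    show b + (α + 2 * N + 1) = α + b + 2 * N + 1 by ring,
    Real.Gamma_add_one (s := α + b + 2 * N) (by linarith),
    show b + (α + 2 * N) = α + b + 2 * N by ring,
    show α + 2 * N - N + 1 = α + N + 1 by ring, show α + b + 2 * N - N = α + b + N by ring]
  have h1 : Real.Gamma b ≠ 0 := (Real.Gamma_pos_of_pos hb0).ne'
  have h2 : Real.Gamma (α + b + 2 * N) ≠ 0 := (Real.Gamma_pos_of_pos (by linarith)).ne'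
  have h3 : Real.Gamma (α + N + 1) ≠ 0 := (Real.Gamma_pos_of_pos (by linarith)).ne'
  have h4 : Real.Gamma (α + b + N) ≠ 0 := (Real.Gamma_pos_of_pos (by linarith)).ne'
  have h5 : α + b + 2 * N ≠ 0 := by linarith
  have h6 : ((-4 : ℝ) ^ N) * (-4) ^ N = 2 ^ (4 * N) := by
    rw [← mul_pow, pow_mul]; norm_num
  rw [← h6]
  field_simp

/-- One even step is integrated by parts first, replacing the test polynomial q by bq + Xq'; the N
remaining double steps go as in the even case. -/
theorem betaMoment_radialPoly_odd {b α : ℝ} (hb : 1 ≤ b) (hα : -1 < α) (N : ℕ) :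
    betaMoment (b + 1) (α + 1) (radialPoly b (α + (2 * N + 1)) (2 * N + 1) ^ 2) =
      2 ^ (4 * N + 2) * Real.Gamma (α + 2 * N + 2) ^ 2 * Real.Gamma (b + N + 1) * N.factorial /
        (Real.Gamma (α + N + 1) * Real.Gamma (α + b + N + 1) * (α + b + 2 * N + 1)) := by
  have hN : (0 : ℝ) ≤ N := N.cast_nonneg
  have hb0 : 0 < b := by linarith
  set g : ℝ := α + (2 * N + 1) with hgdef
  have hg : -1 < g - 2 * N := by linarith
  set q := radialPoly b g (2 * N + 1) with hq
  have hqc : ∀ n, q.coeff n = 2 * ((n + 1) * (radialPoly b g (2 * N)).coeff (n + 1)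
      - (n + (g - 2 * N)) * (radialPoly b g (2 * N)).coeff n) := by
    intro n
    rw [hq, radialPoly_two_mul_succ, coeff_C_mul, coeff_evenStep]
  -- The operator bq + Xq' is diagonal on monomials, so the degree stays at most N.
  have hc : ∀ n, (C b * q + X * derivative q).coeff n = (b + n) * q.coeff n := by
    intro n
    cases n with
    | zero => simp
    | succ n =>
      simp [coeff_derivative]
      ring
  have e : q ^ 2 = C 2 * (q * evenStep (g - 2 * N) (radialPoly b g (2 * N))) := by
    rw [sq]
    nth_rewrite 2 [hq]
    rw [radialPoly_two_mul_succ]; ring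
  have h := betaMoment_mul_radialPoly hb0 N hg (C b * q + X * derivative q)
  rw [iterate_besselOp hb0 N, hc, hqc, coeff_radialPoly hb N hg,
    coeff_radialPoly_eq_zero _ _ N (N + 1) (by omega),
    betaMoment_C hb0 (by linarith)] at h
  · rw [e, betaMoment_C_mul, show α + 1 = g - 2 * N by rw [hgdef]; ring,
      betaMoment_mul_evenStep hb0 (by linarith), h,
      show b + (g + 1) = (b + g) + 1 by ring, Real.Gamma_add_one (s := b + g) (by linarith),
      show g - N + 1 = (α + N + 1) + 1 by rw [hgdef]; ring,
      show b + g - N = α + b + N + 1 by rw [hgdef]; ring,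
      Real.Gamma_add_one (s := α + N + 1) (by linarith),
      Real.Gamma_add_one (s := b + N) (by linarith),
      show α + 2 * N + 2 = g + 1 by rw [hgdef]; ring,
      show α + b + 2 * N + 1 = b + g by rw [hgdef]; ring,
      show (N : ℝ) + (g - 2 * N) = α + N + 1 by rw [hgdef]; ring]
    have h1 : Real.Gamma b ≠ 0 := (Real.Gamma_pos_of_pos hb0).ne'
    have h2 : Real.Gamma (b + g) ≠ 0 := (Real.Gamma_pos_of_pos (by linarith)).ne'
    have h3 : Real.Gamma (α + N + 1) ≠ 0 := (Real.Gamma_pos_of_pos (by linarith)).ne'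
    have h4 : Real.Gamma (α + b + N + 1) ≠ 0 := (Real.Gamma_pos_of_pos (by linarith)).ne'
    have h5 : b + g ≠ 0 := by linarith
    have h7 : α + N + 1 ≠ 0 := by linarith
    have h6 : ((-4 : ℝ) ^ N) * (-4) ^ N * 4 = 2 ^ (4 * N + 2) := by
      rw [← mul_pow, pow_add, pow_mul]; norm_num
    rw [← h6]
    field_simp
    ring
  · intro n hn
    rw [hc, hqc, coeff_radialPoly_eq_zero _ _ N n hn, coeff_radialPoly_eq_zero _ _ N _ (by omega)]
    ring

end BetaMoment

/-! ### Vectors in the Clifford algebra -/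

namespace Cl

variable {m : ℕ}

theorem add_mul (a b c : Cl m) : mul (a + b) c = mul a c + mul b c := by
  ext C
  simp only [mul_apply, PiLp.add_apply, ← Finset.sum_add_distrib]
  exact Finset.sum_congr rfl fun A _ => by ring

theorem mul_add (a b c : Cl m) : mul a (b + c) = mul a b + mul a c := by
  ext C
  simp only [mul_apply, PiLp.add_apply, ← Finset.sum_add_distrib]
  exact Finset.sum_congr rfl fun A _ => by ring

theorem smul_mul (t : ℝ) (a b : Cl m) : mul (t • a) b = t • mul a b := by
  ext C
  simp only [mul_apply, PiLp.smul_apply, Finset.smul_sum, Complex.real_smul]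
  exact Finset.sum_congr rfl fun A _ => by ring

theorem mul_smul (t : ℝ) (a b : Cl m) : mul a (t • b) = t • mul a b := by
  ext C
  simp only [mul_apply, PiLp.smul_apply, Finset.smul_sum, Complex.real_smul]
  exact Finset.sum_congr rfl fun A _ => by ring

/-- The Clifford product as a real bilinear map. -/
def mulₗ : Cl m →ₗ[ℝ] Cl m →ₗ[ℝ] Cl m := LinearMap.mk₂ ℝ mul add_mul smul_mul mul_add mul_smul

/-- The Clifford product as a continuous real bilinear map. -/
def mulL : Cl m →L[ℝ] Cl m →L[ℝ] Cl m :=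
  LinearMap.toContinuousLinearMap
    ((LinearMap.toContinuousLinearMap (𝕜 := ℝ) (E := Cl m) (F' := Cl m)).toLinearMap ∘ₗ mulₗ)

theorem mulL_apply (a b : Cl m) : mulL a b = mul a b := rfl

theorem continuous_mul {T : Type*} [TopologicalSpace T] {f g : T → Cl m} (hf : Continuous f)
    (hg : Continuous g) : Continuous fun t => mul (f t) (g t) :=
  (mulL.continuous.comp hf).clm_apply hg

theorem mul_neg (a b : Cl m) : mul a (-b) = -mul a b := by
  simp only [← mulL_apply, map_neg]

theorem neg_mul (a b : Cl m) : mul (-a) b = -mul a b := by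
  simp only [← mulL_apply, map_neg, neg_apply]

theorem mul_sum {ι : Type*} (s : Finset ι) (a : Cl m) (f : ι → Cl m) :
    mul a (∑ i ∈ s, f i) = ∑ i ∈ s, mul a (f i) := by
  simp only [← mulL_apply, map_sum]

theorem sum_mul {ι : Type*} (s : Finset ι) (f : ι → Cl m) (a : Cl m) :
    mul (∑ i ∈ s, f i) a = ∑ i ∈ s, mul (f i) a := by
  simp only [← mulL_apply, map_sum, sum_apply]

/-- The embedding of `ℝ^m` into the Clifford algebra as the space of vectors. -/
def vec : E m →L[ℝ] Cl m :=
  ∑ j, (EuclideanSpace.proj j : E m →L[ℝ] ℝ).smulRight (gen j)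

theorem vec_apply (x : E m) : vec x = ∑ j, x j • gen j := by
  simp [vec]

theorem vec_single (j : Fin m) : vec (EuclideanSpace.single j (1 : ℝ)) = gen j := by
  rw [vec_apply, Finset.sum_eq_single j]
  · simp
  · intro i _ hi
    simp [hi]
  · simp

theorem gen_mul_vec (j : Fin m) (x : E m) :
    mul (gen j) (vec x) = -mul (vec x) (gen j) - (2 * x j) • one := by
  have h : ∀ i, mul (gen j) (gen i) = -mul (gen i) (gen j) - (if i = j then (2 : ℝ) else 0) • one := by
    intro i
    split_ifs with hij
    · subst hij
      rw [gen_mul_self]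
      module
    · rw [gen_anticomm (Ne.symm hij)]
      simp
  rw [vec_apply, mul_sum, sum_mul, ← Finset.sum_neg_distrib]
  have e : (2 * x j) • (one : Cl m) = ∑ i, (x i * if i = j then (2 : ℝ) else 0) • one := by
    rw [← Finset.sum_smul]
    simp [mul_comm]
  rw [e, ← Finset.sum_sub_distrib]
  refine Finset.sum_congr rfl fun i _ => ?_
  rw [mul_smul, smul_mul, h]
  module

/-- Expanding the left factor and moving each generator across x gives x² = -x² - 2|x|²; then halve.
-/
theorem vec_mul_self (x : E m) : mul (vec x) (vec x) = -(‖x‖ ^ 2) • one := by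
  have h : mul (vec x) (vec x) = -mul (vec x) (vec x) - (2 * ‖x‖ ^ 2) • one := by
    conv_lhs => rw [vec_apply x, sum_mul, ← vec_apply]
    conv_rhs =>
      enter [1, 1, 2]
      rw [vec_apply x]
    rw [mul_sum, ← Finset.sum_neg_distrib, EuclideanSpace.real_norm_sq_eq, Finset.mul_sum,
      Finset.sum_smul, ← Finset.sum_sub_distrib]
    refine Finset.sum_congr rfl fun i _ => ?_
    rw [smul_mul, mul_smul, gen_mul_vec]
    module
  have h2 : (2 : ℝ) • mul (vec x) (vec x) = (2 : ℝ) • (-(‖x‖ ^ 2) • one) := by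
    rw [two_smul]
    nth_rewrite 1 [h]
    module
  exact smul_right_injective _ two_ne_zero h2

theorem vec_mul_vec_mul (x : E m) (a : Cl m) :
    mul (vec x) (mul (vec x) a) = -(‖x‖ ^ 2) • a := by
  rw [← mul_assoc, vec_mul_self, smul_mul, one_mul]

theorem conj_vec (x : E m) : conj (vec x) = -vec x := by
  ext A
  have h := fun j => congrArg (fun a : Cl m => a A) (conj_gen j)
  simp only [conj_apply, PiLp.neg_apply] at h
  simp only [conj_apply, vec_apply, WithLp.ofLp_sum, Finset.sum_apply, PiLp.smul_apply, map_sum,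
    Finset.mul_sum, PiLp.neg_apply, ← Finset.sum_neg_distrib, Complex.real_smul, map_mul,
    Complex.conj_ofReal]
  refine Finset.sum_congr rfl fun i _ => ?_
  linear_combination (x i : ℂ) * h i

/-- The squared norm of xa is the scalar part of conj(a) conj(x) x a, and conj(x) x = -x² = |x|² is
a real scalar. -/
theorem norm_vec_mul_sq (x : E m) (a : Cl m) : ‖mul (vec x) a‖ ^ 2 = ‖x‖ ^ 2 * ‖a‖ ^ 2 := by
  have h := scalarPart_conj_mul_self (mul (vec x) a)
  have h2 := scalarPart_conj_mul_self a
  rw [conj_mul, conj_vec, mul_assoc, neg_mul, vec_mul_vec_mul, mul_neg, mul_smul] at h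
  rw [scalarPart] at h h2
  simp only [PiLp.neg_apply, PiLp.smul_apply, h2, Complex.real_smul] at h
  have h3 : (‖mul (vec x) a‖ ^ 2 : ℝ) = -(-(‖x‖ ^ 2) * ‖a‖ ^ 2) := by exact_mod_cast h.symm
  rw [h3]; ring

theorem continuous_conj : Continuous (conj : Cl m → Cl m) := by
  refine continuous_finsetSum _ fun A _ => ?_
  refine Continuous.smul (f := fun a : Cl m => (-1 : ℂ) ^ (A.card * (A.card + 1) / 2) *
    starRingEnd ℂ (a A)) (g := fun _ => blade A) ?_ continuous_const
  exact continuous_const.mul (Complex.continuous_conj.comp (EuclideanSpace.proj A : Cl m →L[ℂ] ℂ).continuous)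

end Cl

/-! ### The Dirac operator on radial multiples of spherical monogenics -/

variable {m : ℕ}

theorem dirac_smul {φ : E m → ℝ} {φ' : ℝ} {F : E m → Cl m} {x : E m}
    (hφ : HasFDerivAt φ (φ' • innerSL ℝ x) x) (hF : DifferentiableAt ℝ F x) :
    dirac (fun y => φ y • F y) x = φ' • Cl.mul (Cl.vec x) (F x) + φ x • dirac F x := by
  have h := hφ.smul hF.hasFDerivAt
  rw [dirac, dirac, Cl.vec_apply, Cl.sum_mul, Finset.smul_sum, Finset.smul_sum,
    ← Finset.sum_add_distrib]
  refine Finset.sum_congr rfl fun j _ => ?_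
  have e : fderiv ℝ (fun y => φ y • F y) x = _ := h.fderiv
  rw [e]
  simp only [add_apply, smul_apply,
    ContinuousLinearMap.smulRight_apply, innerSL_apply_apply, Cl.mul_add, Cl.mul_smul, Cl.smul_mul,
    EuclideanSpace.inner_single_right]
  simp
  module

/-- In the Leibniz rule the terms e_j e_j F give -mF, while moving e_j across x leaves -x∂F and,
through -2x_j, twice the Euler derivative of F. -/
theorem dirac_vec_mul {F : E m → Cl m} {x : E m} (hF : DifferentiableAt ℝ F x) :
    dirac (fun y => Cl.mul (Cl.vec y) (F y)) x =
      -(m : ℝ) • F x - (2 : ℝ) • fderiv ℝ F x x - Cl.mul (Cl.vec x) (dirac F x) := by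
  have h := Cl.mulL.hasFDerivAt_of_bilinear (Cl.vec (m := m)).hasFDerivAt hF.hasFDerivAt (x := x)
  have e : fderiv ℝ (fun y => Cl.mul (Cl.vec y) (F y)) x = _ := h.fderiv
  have hx : x = ∑ j, x j • EuclideanSpace.single j (1 : ℝ) := by
    ext i
    simp [WithLp.ofLp_sum, Pi.single_apply]
  have hm : -(m : ℝ) • F x = ∑ _j : Fin m, -F x := by simp [Nat.cast_smul_eq_nsmul]
  have hE : fderiv ℝ F x x = ∑ j, x j • fderiv ℝ F x (EuclideanSpace.single j 1) := by
    conv_lhs => enter [2]; rw [hx]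
    simp only [map_sum, map_smul]
  rw [dirac, dirac, hm, hE, Cl.mul_sum, Finset.smul_sum, ← Finset.sum_sub_distrib,
    ← Finset.sum_sub_distrib]
  refine Finset.sum_congr rfl fun j _ => ?_
  have ej : fderiv ℝ (fun y => Cl.mul (Cl.vec y) (F y)) x (EuclideanSpace.single j 1) =
      Cl.mul (Cl.vec x) (fderiv ℝ F x (EuclideanSpace.single j 1)) + Cl.mul (Cl.gen j) (F x) := by
    rw [e, ← Cl.vec_single]
    rfl
  rw [ej, Cl.mul_add, ← Cl.mul_assoc, ← Cl.mul_assoc, Cl.gen_mul_vec, Cl.gen_mul_self, Cl.neg_mul, Cl.one_mul,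
    sub_eq_add_neg, Cl.add_mul, Cl.neg_mul, Cl.neg_mul, Cl.smul_mul, Cl.one_mul, Cl.mul_assoc]
  module

theorem dirac_congr {F G : E m → Cl m} {x : E m} (h : F =ᶠ[nhds x] G) : dirac F x = dirac G x := by
  rw [dirac, dirac, h.fderiv_eq]

theorem IsHomogeneousPolynomial.map_smul {k : ℕ} {Y : E m → Cl m} (hY : IsHomogeneousPolynomial k Y)
    (t : ℝ) (x : E m) : Y (t • x) = t ^ k • Y x := by
  obtain ⟨P, hP, hY⟩ := hY
  ext A
  rw [PiLp.smul_apply, hY, hY, MvPolynomial.eval_eq, MvPolynomial.eval_eq, Finset.smul_sum]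
  refine Finset.sum_congr rfl fun d hd => ?_
  have hd' : ∑ i ∈ d.support, d i = k := by
    rw [← hP A (MvPolynomial.mem_support_iff.1 hd), Finsupp.weight_apply, Finsupp.sum]; simp
  simp only [PiLp.smul_apply, smul_eq_mul, Complex.ofReal_mul, mul_pow, Finset.prod_mul_distrib,
    Finset.prod_pow_eq_pow_sum, hd', Complex.real_smul, Complex.ofReal_pow]
  ring

/-- Euler's identity, from differentiating Y(tx) = t^k Y(x) at t = 1. -/
theorem IsHomogeneousPolynomial.fderiv_self {k : ℕ} {Y : E m → Cl m}
    (hY : IsHomogeneousPolynomial k Y) (hd : Differentiable ℝ Y) (x : E m) :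
    fderiv ℝ Y x x = (k : ℝ) • Y x := by
  have h1 : HasDerivAt (fun t : ℝ => t • x) x 1 := by
    simpa using (hasDerivAt_id (1 : ℝ)).smul_const x
  have h2 : HasDerivAt (fun t : ℝ => Y (t • x)) (fderiv ℝ Y x x) 1 := by
    have h := (hd ((1 : ℝ) • x)).hasFDerivAt.comp_hasDerivAt 1 h1
    rwa [one_smul] at h
  have h3 : HasDerivAt (fun t : ℝ => Y (t • x)) ((k : ℝ) • Y x) 1 := by
    simp only [hY.map_smul]
    simpa using (hasDerivAt_pow k (1 : ℝ)).smul_const (Y x)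
  exact h2.unique h3

theorem hasFDerivAt_comp_norm_sq {f : ℝ → ℝ} {f' : ℝ} {x : E m} (hf : HasDerivAt f f' (‖x‖ ^ 2)) :
    HasFDerivAt (fun y : E m => f (‖y‖ ^ 2)) ((2 * f') • innerSL ℝ x) x := by
  have h := hf.comp_hasFDerivAt x (hasStrictFDerivAt_norm_sq x).hasFDerivAt
  refine h.congr_fderiv ?_
  ext y
  simp
  ring

/-- `∂_x^n` of `(1 - |x|²) ^ g Y` on the unit ball, without the power of `1 - |x|²`. -/
def radialFun (b g : ℝ) (n : ℕ) (Y : E m → Cl m) (x : E m) : Cl m :=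
  ((radialPoly b g n).eval (‖x‖ ^ 2)) • (if Even n then Y x else Cl.mul (Cl.vec x) (Y x))

theorem norm_sq_lt_one {x : E m} (hx : x ∈ Metric.ball (0 : E m) 1) : ‖x‖ ^ 2 < 1 := by
  rw [mem_ball_zero_iff] at hx
  exact pow_lt_one₀ (norm_nonneg x) hx two_ne_zero

theorem hasDerivAt_one_sub_rpow_mul (d : ℝ) (P : Polynomial ℝ) {s : ℝ} (hs : s < 1) :
    HasDerivAt (fun s => (1 - s) ^ d * P.eval s) ((1 - s) ^ (d - 1) * (evenStep d P).eval s) s := by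
  have hs1 : 0 < 1 - s := sub_pos.2 hs
  have h := (((hasDerivAt_id s).const_sub 1).rpow_const (p := d) (Or.inl hs1.ne')).mul (P.hasDerivAt s)
  refine h.congr_deriv ?_
  have e2 : (1 - s) ^ d = (1 - s) ^ (d - 1) * (1 - s) := by
    rw [← Real.rpow_add_one hs1.ne']; ring_nf
  simp only [evenStep, Polynomial.eval_sub, Polynomial.eval_mul, Polynomial.eval_C,
    Polynomial.eval_X, Polynomial.eval_one, id, e2]
  ring

theorem iterate_dirac {k : ℕ} {Y : E m → Cl m} (hY : Y ∈ sphericalMonogenics m k) (g : ℝ) (n : ℕ)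
    {x : E m} (hx : x ∈ Metric.ball (0 : E m) 1) :
    (dirac^[n] fun y => ((1 - ‖y‖ ^ 2) ^ g : ℝ) • Y y) x =
      ((1 - ‖x‖ ^ 2) ^ (g - n) : ℝ) • radialFun (k + (m : ℝ) / 2) g n Y x := by
  obtain ⟨hhom, hC, hmono⟩ := hY
  have hd : Differentiable ℝ Y := hC.differentiable one_ne_zero
  induction n generalizing x with
  | zero => simp [radialFun, radialPoly]
  | succ n ih =>
    have hs := norm_sq_lt_one hx
    -- The induction hypothesis holds on the open ball, hence near x, so it may be differentiated
    -- there.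
    have hev : (dirac^[n] fun y => ((1 - ‖y‖ ^ 2) ^ g : ℝ) • Y y) =ᶠ[nhds x] fun y =>
        ((1 - ‖y‖ ^ 2) ^ (g - n) * (radialPoly (k + (m : ℝ) / 2) g n).eval (‖y‖ ^ 2)) •
          (if Even n then Y y else Cl.mul (Cl.vec y) (Y y)) := by
      filter_upwards [Metric.isOpen_ball.mem_nhds hx] with y hy
      rw [ih hy, radialFun, smul_smul]
    have hφ := hasFDerivAt_comp_norm_sq
      (hasDerivAt_one_sub_rpow_mul (g - n) (radialPoly (k + (m : ℝ) / 2) g n) hs)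
    have hexp : g - (n + 1 : ℕ) = g - n - 1 := by push_cast; ring
    rw [Function.iterate_succ_apply', dirac_congr hev, radialFun, hexp]
    by_cases hn : Even n
    · have hn' : ¬ Even (n + 1) := by simpa [Nat.even_add_one] using hn
      simp only [if_pos hn, if_neg hn']
      rw [dirac_smul hφ (hd x), hmono, smul_zero, add_zero, radialPoly, if_pos hn, smul_smul]
      simp only [Polynomial.eval_mul, Polynomial.eval_C]
      congr 1
      ring
    · have hn' : Even (n + 1) := by simpa [Nat.even_add_one] using hn
      have hd' : DifferentiableAt ℝ (fun y => Cl.mul (Cl.vec y) (Y y)) x :=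
        (Cl.mulL.hasFDerivAt_of_bilinear (Cl.vec (m := m)).hasFDerivAt (hd x).hasFDerivAt
          (x := x)).differentiableAt
      have e2 : (1 - ‖x‖ ^ 2) ^ (g - n) = (1 - ‖x‖ ^ 2) ^ (g - n - 1) * (1 - ‖x‖ ^ 2) := by
        rw [← Real.rpow_add_one (sub_pos.2 hs).ne']; ring_nf
      simp only [if_neg hn, if_pos hn']
      rw [dirac_smul hφ hd', dirac_vec_mul (hd x), hmono, hhom.fderiv_self hd, Cl.vec_mul_vec_mul,
        radialPoly, if_neg hn, ← Cl.mulL_apply, map_zero, e2]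
      simp only [Polynomial.eval_mul, Polynomial.eval_C, evenStep, oddStep, Polynomial.eval_sub,
        Polynomial.eval_add, Polynomial.eval_X, Polynomial.eval_one]
      module

theorem cgp_eq_radialFun {k : ℕ} {Y : E m → Cl m} (hY : Y ∈ sphericalMonogenics m k) (α : ℝ) (n : ℕ)
    {x : E m} (hx : x ∈ Metric.ball (0 : E m) 1) :
    cgp α n Y x = radialFun (k + (m : ℝ) / 2) (α + n) n Y x := by
  have hs : 0 < 1 - ‖x‖ ^ 2 := sub_pos.2 (norm_sq_lt_one hx)
  rw [cgp, iterate_dirac hY _ n hx, smul_smul, ← Real.rpow_add hs]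
  simp

theorem continuous_radialFun (b g : ℝ) (n : ℕ) {Y : E m → Cl m} (hY : Continuous Y) :
    Continuous (radialFun b g n Y) := by
  refine Continuous.smul ((radialPoly b g n).continuous.comp (by fun_prop)) ?_
  split_ifs
  · exact hY
  · exact Cl.continuous_mul Cl.vec.continuous hY

theorem norm_radialFun_sq (b g : ℝ) (n : ℕ) (Y : E m → Cl m) (x : E m) :
    ‖radialFun b g n Y x‖ ^ 2 =
      ((radialPoly b g n) ^ 2).eval (‖x‖ ^ 2) * (if Even n then 1 else ‖x‖ ^ 2) * ‖Y x‖ ^ 2 := by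
  rw [radialFun, norm_smul, mul_pow, Real.norm_eq_abs, sq_abs, Polynomial.eval_pow]
  split_ifs
  · ring
  · rw [Cl.norm_vec_mul_sq]; ring

/-! ### Polar coordinates and reduction to beta integrals -/

open Set

theorem integrable_volumeIoiPow {n : ℕ} {f : ℝ → ℝ}
    (hf : IntegrableOn (fun r => r ^ n * f r) (Ioi 0)) :
    Integrable (fun r : Ioi (0 : ℝ) => f r) (Measure.volumeIoiPow n) := by
  rw [integrableOn_iff_comap_subtypeVal measurableSet_Ioi] at hf
  rw [Measure.volumeIoiPow, integrable_withDensity_iff_integrable_smul' (by fun_prop) (by simp)]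
  refine hf.congr (.of_forall ?_)
  rintro ⟨r, hr : 0 < r⟩
  simp [ENNReal.toReal_ofReal (pow_nonneg hr.le n)]

theorem integral_volumeIoiPow (n : ℕ) (f : ℝ → ℝ) :
    ∫ r : Ioi (0 : ℝ), f r ∂(Measure.volumeIoiPow n) = ∫ r in Ioi (0 : ℝ), r ^ n * f r := by
  simp only [Measure.volumeIoiPow, ENNReal.ofReal]
  rw [integral_withDensity_eq_integral_smul,
    integral_subtype_comap measurableSet_Ioi fun a ↦ Real.toNNReal (a ^ n) • f a,
    setIntegral_congr_fun measurableSet_Ioi fun x hx ↦ ?_]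
  · rw [NNReal.smul_def, Real.coe_toNNReal _ (pow_nonneg hx.out.le _), smul_eq_mul]
  · exact (measurable_subtype_coe.pow_const _).real_toNNReal

/-- Integration in polar coordinates of a product of a radial and a homogeneous function. -/
theorem integral_radial_mul_homogeneous [NeZero m] {d : ℕ} {H : E m → ℝ} (hH : Continuous H)
    (hhom : ∀ t : ℝ, ∀ x, H (t • x) = t ^ d * H x) {G : ℝ → ℝ}
    (hG : IntegrableOn (fun r => r ^ (m - 1) * (r ^ d * G r)) (Ioi 0)) :
    Integrable (fun x : E m => G ‖x‖ * H x) ∧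
      ∫ x : E m, G ‖x‖ * H x = (∫ ω : Metric.sphere (0 : E m) 1, H ω
          ∂((volume : Measure (E m)).toSphere)) * ∫ r in Ioi (0 : ℝ), r ^ (m - 1) * (r ^ d * G r) := by
  set μ : Measure (E m) := volume
  have hdim : Module.finrank ℝ (E m) - 1 = m - 1 := by simp
  have hmp := μ.measurePreserving_homeomorphUnitSphereProd
  rw [hdim] at hmp
  have hemb := (homeomorphUnitSphereProd (E m)).measurableEmbedding
  let g : Metric.sphere (0 : E m) 1 × Ioi (0 : ℝ) → ℝ := fun p => H p.1 * (p.2.1 ^ d * G p.2)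
  have hg : ∀ x : ({0}ᶜ : Set (E m)), G ‖x.1‖ * H x = g (homeomorphUnitSphereProd (E m) x) := by
    intro x
    have hx : ‖x.1‖ ≠ 0 := norm_ne_zero_iff.2 x.2
    have e : x.1 = ‖x.1‖ • ((homeomorphUnitSphereProd (E m) x).1 : E m) := by
      rw [homeomorphUnitSphereProd_apply_fst_coe, smul_smul, mul_inv_cancel₀ hx, one_smul]
    change _ = H (homeomorphUnitSphereProd (E m) x).1 * (_ ^ d * G _)
    rw [homeomorphUnitSphereProd_apply_snd_coe]
    nth_rewrite 2 [e]
    rw [hhom]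
    ring
  have hHi : Integrable (fun ω : Metric.sphere (0 : E m) 1 => H ω) μ.toSphere :=
    (hH.comp continuous_subtype_val).integrable_of_hasCompactSupport
      (HasCompactSupport.of_compactSpace _)
  have hGi := integrable_volumeIoiPow hG
  constructor
  · have h := hHi.mul_prod hGi
    rw [← hmp.integrable_comp_emb hemb] at h
    -- Polar coordinates live on the punctured space; the origin is a null set.
    rw [← restrict_compl_singleton (μ := μ) 0, ← IntegrableOn,
      integrableOn_iff_comap_subtypeVal (by measurability)]
    exact h.congr (.of_forall fun x => (hg x).symm)
  · have h0 : ∫ x, G ‖x‖ * H x ∂μ = ∫ x : ({0}ᶜ : Set (E m)), G ‖x.1‖ * H x ∂(μ.comap (↑)) := by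
      rw [integral_subtype_comap (measurableSet_singleton _).compl fun x => G ‖x‖ * H x,
        restrict_compl_singleton]
    rw [h0, ← integral_volumeIoiPow, ← integral_prod_mul, ← hmp.integral_comp hemb]
    exact integral_congr_ae (.of_forall hg)

/-- Substitution s = r², whose Jacobian gives the factor 1/2; the indicator confines the integral to
the unit ball. -/
theorem integral_radial_eq_betaMoment (hm : m ≠ 0) (k : ℕ) {α : ℝ} (hα : -1 < α)
    (Q : Polynomial ℝ) :
    IntegrableOn (fun r : ℝ => r ^ (m - 1) * (r ^ (2 * k) *
        (Iio (1 : ℝ)).indicator (fun s => Q.eval s * (1 - s) ^ α) (r ^ 2))) (Ioi 0) ∧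
      ∫ r in Ioi (0 : ℝ), r ^ (m - 1) * (r ^ (2 * k) *
        (Iio (1 : ℝ)).indicator (fun s => Q.eval s * (1 - s) ^ α) (r ^ 2)) =
        betaMoment (k + (m : ℝ) / 2) (α + 1) Q / 2 := by
  set b : ℝ := k + (m : ℝ) / 2 with hb
  have hb0 : 0 < b := by positivity
  let g : ℝ → ℝ := (Ioo (0 : ℝ) 1).indicator
    fun s => Q.eval s * (s ^ (b - 1) * (1 - s) ^ (α + 1 - 1))
  have hgi : IntegrableOn g (Ioi 0) :=
    ((integrable_indicator_iff measurableSet_Ioo).2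
      (integrableOn_eval_mul_betaWeight hb0 (by linarith) Q)).integrableOn
  have hg : ∫ s in Ioi (0 : ℝ), g s = betaMoment b (α + 1) Q := by
    rw [setIntegral_indicator measurableSet_Ioo, inter_eq_right.2 Ioo_subset_Ioi_self, betaMoment]
  have key : EqOn (fun r : ℝ => r ^ ((2 : ℝ) - 1) • g (r ^ (2 : ℝ))) (fun r : ℝ => r ^ (m - 1) *
      (r ^ (2 * k) * (Iio (1 : ℝ)).indicator (fun s => Q.eval s * (1 - s) ^ α) (r ^ 2))) (Ioi 0) := by
    intro r (hr : 0 < r)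
    have hr2 : 0 < r ^ 2 := by positivity
    -- Exponents match since 1 + 2(b - 1) = (m - 1) + 2k.
    have e : r * (r ^ 2) ^ (b - 1) = r ^ (m - 1) * r ^ (2 * k) := by
      rw [← Real.rpow_natCast r 2, ← Real.rpow_mul hr.le, mul_comm, ← Real.rpow_add_one hr.ne',
        ← pow_add, ← Real.rpow_natCast]
      congr 1
      rw [hb]
      push_cast [Nat.cast_sub (Nat.one_le_iff_ne_zero.2 hm)]
      ring
    have e1 : r ^ ((2 : ℝ) - 1) = r := by norm_num
    simp only [Real.rpow_two, e1, g, smul_eq_mul]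
    by_cases h1 : r ^ 2 < 1
    · rw [indicator_of_mem (show r ^ 2 ∈ Ioo (0 : ℝ) 1 from ⟨hr2, h1⟩), indicator_of_mem
        (show r ^ 2 ∈ Iio (1 : ℝ) from h1), add_sub_cancel_right]
      linear_combination (Q.eval (r ^ 2) * (1 - r ^ 2) ^ α) * e
    · rw [indicator_of_notMem (show r ^ 2 ∉ Ioo (0 : ℝ) 1 from fun h => h1 h.2),
        indicator_of_notMem (show r ^ 2 ∉ Iio (1 : ℝ) from h1)]
      simp
  constructor
  · exact ((integrableOn_Ioi_comp_rpow_iff' g two_ne_zero).2 hgi).congr_fun key measurableSet_Ioi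
  · rw [← setIntegral_congr_fun measurableSet_Ioi key, ← hg,
      ← integral_comp_rpow_Ioi_of_pos (g := g) (p := 2) two_pos]
    simp only [smul_eq_mul, mul_assoc, integral_const_mul]
    ring

/-- Taking the scalar part is continuous and linear, so it passes under the integral, where conj(Y)Y
has scalar part |Y|². -/
theorem integral_sphere_norm_sq {Y : E m → Cl m} (hY : Continuous Y)
    (h : sphereInner Y Y = Cl.one) :
    ∫ ω : Metric.sphere (0 : E m) 1, ‖Y ω‖ ^ 2 ∂((volume : Measure (E m)).toSphere) = 1 := by
  have hc : Continuous fun x : E m => Cl.mul (Cl.conj (Y x)) (Y x) := Cl.continuous_mul (Cl.continuous_conj.comp hY) hY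
  have hi : Integrable (fun ω : Metric.sphere (0 : E m) 1 => Cl.mul (Cl.conj (Y ω)) (Y ω))
      (volume : Measure (E m)).toSphere :=
    (hc.comp continuous_subtype_val).integrable_of_hasCompactSupport
      (HasCompactSupport.of_compactSpace _)
  have h2 := (EuclideanSpace.proj ∅ : Cl m →L[ℂ] ℂ).integral_comp_comm hi
  have h3 : ∀ ω : Metric.sphere (0 : E m) 1, (EuclideanSpace.proj ∅ : Cl m →L[ℂ] ℂ)
      (Cl.mul (Cl.conj (Y ω)) (Y ω)) = ((‖Y ω‖ ^ 2 : ℝ) : ℂ) :=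
    fun ω => Cl.scalarPart_conj_mul_self (Y ω)
  simp only [h3] at h2
  rw [integral_complex_ofReal, ← sphereInner, h] at h2
  have h4 : (EuclideanSpace.proj ∅ : Cl m →L[ℂ] ℂ) Cl.one = 1 := by simp [Cl.one, Cl.blade]
  rw [h4] at h2
  exact_mod_cast h2

theorem memL2_cgp_and_weightedNorm_sq [NeZero m] {k : ℕ} {Y : E m → Cl m}
    (hY : Y ∈ sphericalMonogenics m k) (h : sphereInner Y Y = Cl.one) {α : ℝ} (hα : -1 < α) (n : ℕ) :
    MemL2 α (cgp α n Y) ∧ weightedNorm α (cgp α n Y) ^ 2 =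
      betaMoment (k + (m : ℝ) / 2) (α + 1) ((if Even n then 1 else Polynomial.X) *
        radialPoly (k + (m : ℝ) / 2) (α + n) n ^ 2) / 2 := by
  have hYc : Continuous Y := hY.2.1.continuous
  set b : ℝ := k + (m : ℝ) / 2
  set Q : Polynomial ℝ := (if Even n then 1 else Polynomial.X) * radialPoly b (α + n) n ^ 2 with hQ
  obtain ⟨hi, hv⟩ := integral_radial_eq_betaMoment (NeZero.ne m) k hα Q
  obtain ⟨hi2, hv2⟩ := integral_radial_mul_homogeneous (H := fun x => ‖Y x‖ ^ 2) (d := 2 * k)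
    (G := fun r => (Iio (1 : ℝ)).indicator (fun s => Q.eval s * (1 - s) ^ α) (r ^ 2))
    (by fun_prop) (fun t x => by
      rw [hY.1.map_smul, norm_smul, mul_pow, Real.norm_eq_abs, abs_pow, ← pow_mul, mul_comm k,
        Even.pow_abs (by simp)]) hi
  rw [integral_sphere_norm_sq hYc h, one_mul, hv] at hv2
  have heq : (Metric.ball (0 : E m) 1).indicator
      (fun x => ‖cgp α n Y x‖ ^ 2 * (1 - ‖x‖ ^ 2) ^ α) = fun x =>
        (Iio (1 : ℝ)).indicator (fun s => Q.eval s * (1 - s) ^ α) (‖x‖ ^ 2) * ‖Y x‖ ^ 2 := by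
    funext x
    by_cases hx : x ∈ Metric.ball (0 : E m) 1
    · rw [indicator_of_mem hx, indicator_of_mem (show ‖x‖ ^ 2 ∈ Iio (1 : ℝ) from norm_sq_lt_one hx),
        cgp_eq_radialFun hY α n hx, norm_radialFun_sq, hQ]
      split_ifs <;> simp only [Polynomial.eval_mul, Polynomial.eval_one, Polynomial.eval_X] <;> ring
    · have hx' : ‖x‖ ^ 2 ∉ Iio (1 : ℝ) := by
        rw [mem_ball_zero_iff, not_lt] at hx
        exact not_lt.2 (one_le_pow₀ hx)
      rw [indicator_of_notMem hx, indicator_of_notMem hx', zero_mul]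
  refine ⟨⟨?_, ?_⟩, ?_⟩
  · refine (continuous_radialFun b (α + n) n hYc).aestronglyMeasurable.congr ?_
    filter_upwards [ae_restrict_mem measurableSet_ball] with x hx
    exact (cgp_eq_radialFun hY α n hx).symm
  · rw [← integrable_indicator_iff measurableSet_ball, heq]
    exact hi2
  · rw [weightedNorm, Real.sq_sqrt, ← integral_indicator measurableSet_ball, heq, hv2]
    refine setIntegral_nonneg measurableSet_ball fun x hx => ?_
    have := (sub_pos.2 (norm_sq_lt_one hx)).le
    positivity

end

end CliffordGegenbauer

/-! ### The norm formulas -/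

theorem mainTheorem7 (m : ℕ) (hm : 2 ≤ m) (α : ℝ) (hα : -1 < α) (k N : ℕ)
    {ι : Type*} [DecidableEq ι] (Y : ι → CliffordGegenbauer.E m → CliffordGegenbauer.Cl m)
    (hY : ∀ j, Y j ∈ CliffordGegenbauer.sphericalMonogenics m k)
    (hYorth : ∀ i j, CliffordGegenbauer.sphereInner (Y i) (Y j) =
      if i = j then CliffordGegenbauer.Cl.one else 0)
    (j : ι) :
    (CliffordGegenbauer.MemL2 α (CliffordGegenbauer.cgp α (2 * N) (Y j)) ∧
      CliffordGegenbauer.weightedNorm α (CliffordGegenbauer.cgp α (2 * N) (Y j)) ^ 2 =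
        (2 : ℝ) ^ (4 * N) * Real.Gamma (α + 2 * N + 1) ^ 2 *
            Real.Gamma (k + (m : ℝ) / 2 + N) * (N.factorial : ℝ) /
          (2 * Real.Gamma (α + N + 1) * Real.Gamma (α + k + (m : ℝ) / 2 + N) *
            (α + k + (m : ℝ) / 2 + 2 * N))) ∧
    (CliffordGegenbauer.MemL2 α (CliffordGegenbauer.cgp α (2 * N + 1) (Y j)) ∧
      CliffordGegenbauer.weightedNorm α (CliffordGegenbauer.cgp α (2 * N + 1) (Y j)) ^ 2 =
        (2 : ℝ) ^ (4 * N + 2) * Real.Gamma (α + 2 * N + 2) ^ 2 *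
            Real.Gamma (k + (m : ℝ) / 2 + N + 1) * (N.factorial : ℝ) /
          (2 * Real.Gamma (α + N + 1) * Real.Gamma (α + k + (m : ℝ) / 2 + N + 1) *
            (α + k + (m : ℝ) / 2 + 2 * N + 1))) := by
  have : NeZero m := ⟨by omega⟩
  have hmr : (2 : ℝ) ≤ m := by exact_mod_cast hm
  have hk : (0 : ℝ) ≤ k := k.cast_nonneg
  have hb : 1 ≤ (k : ℝ) + (m : ℝ) / 2 := by linarith
  have hone : CliffordGegenbauer.sphereInner (Y j) (Y j) = CliffordGegenbauer.Cl.one := by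
    simp [hYorth]
  obtain ⟨he, he2⟩ := CliffordGegenbauer.memL2_cgp_and_weightedNorm_sq (hY j) hone hα (2 * N)
  obtain ⟨ho, ho2⟩ := CliffordGegenbauer.memL2_cgp_and_weightedNorm_sq (hY j) hone hα (2 * N + 1)
  refine ⟨⟨he, ?_⟩, ho, ?_⟩
  · rw [he2, if_pos (by simp), one_mul]
    push_cast
    rw [CliffordGegenbauer.betaMoment_radialPoly_even hb hα, ← add_assoc α, div_div]
    congr 1
    ring
  -- The factor X, coming from |xY|² = |x|²|Y|², is absorbed by passing from b to b + 1.
  · rw [ho2, if_neg (by simp), ← CliffordGegenbauer.betaMoment_left_succ]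
    push_cast
    rw [CliffordGegenbauer.betaMoment_radialPoly_odd hb hα, ← add_assoc α, div_div]
    congr 1
    ring
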